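/- Let $A$ be a real $n\times n$ matrix and $C$ a real $d\times n$ matrix such that the output pair $(A,C)$ is stable (every complex eigenvalue of $A$ has modulus less than $1$) and observable ($CA^kx=0$ for all $k\ge 0$ implies $x=0$). Call $(A',C')$ similar to $(A,C)$ if $A'=T^{-1}AT$ and $C'=CT$ for some invertible real matrix $T$, and output normal if $A'^{*}A'=\mathbb{I}_n-C'^{*}C'$, where $*$ denotes the transpose. Then: 1. (OTSON) $(A,C)$ is similar to a real output normal pair $(A',C')$ in observer triangular system form: the stack $Q=\begin{pmatrix}C'\\A'\end{pmatrix}$ satisfies $Q_{i,j}=0$ for $j>i$. 2. (HOON) $(A,C)$ is similar to a real output normal pair $(A',C')$ in Hessenberg observer form: $A'_{i,j}=0$ for $i>j+1$, $C'_{1,j}=0$ for $j>1$, and $C'_{1,1}\ge 0$. 3. (Ordered Schur ON with qd blocks) $(A,C)$ is similar to a real output normal pair $(A',C')$ such that, for some $\ell$ with $2\ell\le n$, $A'$ is block upper triangular with diagonal blocks $Z_1,\dots,Z_{n-\ell}$, where - $Z_1,\dots,Z_\ell$ are $2\times 2$ with non-real eigenvalues, and $Z_{\ell+1},\dots,Z_{n-\ell}$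 are real scalars; - if $i<j\le \ell$ or $\ell<i<j\le n-\ell$, and $\lambda,\mu$ are eigenvalues of $Z_i$ and $Z_j$, then $|\lambda|\le|\mu|$, and $\operatorname{Re}\mu\le\operatorname{Re}\lambda$ if $|\lambda|=|\mu|$; - for each $j\le\ell$ there are $c,s,d_1,d_2\in\mathbb{R}$ with $c^2+s^2=1$, $s\ge 0$, $d_1\ge d_2\ge 0$ and $$Z_j=\begin{pmatrix}c&s\\-s&c\end{pmatrix}\begin{pmatrix}d_1&0\\0&d_2\end{pmatrix}.$$ -/

import Mathlib

namespace OutputPair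

/-- Two real output pairs are similar: `A' = T⁻¹ A T` and `C' = C T` for an invertible real `T`. -/
def Similar {n d : ℕ} (A : Matrix (Fin n) (Fin n) ℝ) (C : Matrix (Fin d) (Fin n) ℝ)
    (A' : Matrix (Fin n) (Fin n) ℝ) (C' : Matrix (Fin d) (Fin n) ℝ) : Prop :=
  ∃ T : (Matrix (Fin n) (Fin n) ℝ)ˣ,
    A' = (↑T⁻¹ : Matrix (Fin n) (Fin n) ℝ) * A * (T : Matrix (Fin n) (Fin n) ℝ) ∧
      C' = C * (T : Matrix (Fin n) (Fin n) ℝ)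

/-- Discrete-time stability: every complex eigenvalue of `A` has modulus less than one. -/
def IsStable {n : ℕ} (A : Matrix (Fin n) (Fin n) ℝ) : Prop :=
  ∀ μ ∈ spectrum ℂ (A.map (algebraMap ℝ ℂ)), ‖μ‖ < 1

/-- Observability: only the zero initial state gives the zero output sequence `C Aᵏ x`. -/
def IsObservable {n d : ℕ} (A : Matrix (Fin n) (Fin n) ℝ)
    (C : Matrix (Fin d) (Fin n) ℝ) : Prop :=
  ∀ x : Fin n → ℝ, (∀ k : ℕ, Matrix.mulVec (C * A ^ k) x = 0) → x = 0

/-- Output normal (ON): `A* A = I - C* C`. -/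
def IsOutputNormal {n d : ℕ} (A : Matrix (Fin n) (Fin n) ℝ)
    (C : Matrix (Fin d) (Fin n) ℝ) : Prop :=
  A.transpose * A = 1 - C.transpose * C

/-- The `(d + n) × n` stack `Q` with the rows of `C` above the rows of `A`. -/
def stack {n d : ℕ} (A : Matrix (Fin n) (Fin n) ℝ) (C : Matrix (Fin d) (Fin n) ℝ) :
    Matrix (Fin (d + n)) (Fin n) ℝ :=
  (Matrix.fromRows C A).submatrix finSumFinEquiv.symm id

/-- Observer triangular system (OTS) form: `Q i j = 0` for `j > i`. -/
def IsOTS {n d : ℕ} (A : Matrix (Fin n) (Fin n) ℝ) (C : Matrix (Fin d) (Fin n) ℝ) : Prop :=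
  ∀ (i : Fin (d + n)) (j : Fin n), (i : ℕ) < (j : ℕ) → stack A C i j = 0

/-- Observer triangular system output normal. -/
def IsOTSON {n d : ℕ} (A : Matrix (Fin n) (Fin n) ℝ) (C : Matrix (Fin d) (Fin n) ℝ) : Prop :=
  IsOTS A C ∧ IsOutputNormal A C

/-- `A` is (upper) Hessenberg: it vanishes below the first subdiagonal. -/
def IsHessenberg {n : ℕ} (A : Matrix (Fin n) (Fin n) ℝ) : Prop :=
  ∀ i j : Fin n, (j : ℕ) + 1 < (i : ℕ) → A i j = 0

/-- Hessenberg observer (HO) form: `A` is Hessenberg, and the first row of `C` vanishes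
except for its first entry, which is nonnegative. -/
def IsHO {n d : ℕ} (A : Matrix (Fin n) (Fin n) ℝ) (C : Matrix (Fin d) (Fin n) ℝ) : Prop :=
  IsHessenberg A ∧
    ∀ (i : Fin d) (j : Fin n), (i : ℕ) = 0 →
      (0 < (j : ℕ) → C i j = 0) ∧ ((j : ℕ) = 0 → 0 ≤ C i j)

/-- Hessenberg observer output normal. -/
def IsHOON {n d : ℕ} (A : Matrix (Fin n) (Fin n) ℝ) (C : Matrix (Fin d) (Fin n) ℝ) : Prop :=
  IsHO A C ∧ IsOutputNormal A C

/-- The (zero-based) number of the diagonal block that contains coordinate `i`, when `l` blocks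
of size two are followed by blocks of size one. -/
def blockIndex {n : ℕ} (l : ℕ) (i : Fin n) : ℕ :=
  if (i : ℕ) < 2 * l then (i : ℕ) / 2 else (i : ℕ) - l

/-- The `k`-th `2 × 2` diagonal block of `A` (zero-based), in rows and columns `2k, 2k + 1`. -/
def diagBlock {n l : ℕ} (A : Matrix (Fin n) (Fin n) ℝ) (hl : 2 * l ≤ n) (k : Fin l) :
    Matrix (Fin 2) (Fin 2) ℝ :=
  let e : Fin 2 → Fin n := fun a => ⟨2 * (k : ℕ) + (a : ℕ), by omega⟩
  A.submatrix e e

/-- The complex eigenvalues of a real `2 × 2` matrix. -/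
def eigs (Z : Matrix (Fin 2) (Fin 2) ℝ) : Set ℂ := spectrum ℂ (Z.map (algebraMap ℝ ℂ))

/-- Real Schur form with `l` leading `2 × 2` diagonal blocks, each carrying a pair of non-real
conjugate eigenvalues, followed by `n - 2 l` scalar blocks: `A` is block upper triangular. -/
def IsRealSchur {n l : ℕ} (A : Matrix (Fin n) (Fin n) ℝ) (hl : 2 * l ≤ n) : Prop :=
  A.BlockTriangular (blockIndex l) ∧
    ∀ k : Fin l, ∀ μ ∈ eigs (diagBlock A hl k), μ.im ≠ 0

/-- The order of the eigenvalues: among the `2 × 2` blocks, and among the scalar blocks,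
moduli are nondecreasing, and real parts are nonincreasing where moduli agree. The two
eigenvalues of one `2 × 2` block are conjugate, so they have the same modulus and real part. -/
def IsOrdered {n l : ℕ} (A : Matrix (Fin n) (Fin n) ℝ) (hl : 2 * l ≤ n) : Prop :=
  (∀ k k' : Fin l, k < k' → ∀ μ ∈ eigs (diagBlock A hl k), ∀ ν ∈ eigs (diagBlock A hl k'),
      ‖μ‖ ≤ ‖ν‖ ∧ (‖ν‖ = ‖μ‖ → ν.re ≤ μ.re)) ∧
    ∀ i j : Fin n, 2 * l ≤ (i : ℕ) → i < j →
      |A i i| ≤ |A j j| ∧ (|A j j| = |A i i| → A j j ≤ A i i)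

/-- The `2 × 2` matrix `Z` is a rotation times a nonnegative diagonal matrix, normalized by
`s ≥ 0` and `d₁ ≥ d₂`. -/
def IsQD (Z : Matrix (Fin 2) (Fin 2) ℝ) : Prop :=
  ∃ c s d₁ d₂ : ℝ, c ^ 2 + s ^ 2 = 1 ∧ 0 ≤ s ∧ 0 ≤ d₂ ∧ d₂ ≤ d₁ ∧
    Z = !![c, s; -s, c] * !![d₁, 0; 0, d₂]

/-- Ordered real Schur form whose `2 × 2` diagonal blocks are all in *qd* form. -/
def IsOrderedSchurQD {n : ℕ} (A : Matrix (Fin n) (Fin n) ℝ) : Prop :=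
  ∃ (l : ℕ) (hl : 2 * l ≤ n),
    IsRealSchur A hl ∧ IsOrdered A hl ∧ ∀ k : Fin l, IsQD (diagBlock A hl k)

end OutputPair

/-! Stability makes the Gramian `P = ∑ (Aᵏ)ᵀ Cᵀ C Aᵏ` converge, observability makes it positive
definite, and shifting the series gives the Stein equation `Aᵀ P A = P - Cᵀ C` (`exists_gramian`). A
congruence taking `P` to the identity turns this equation into output normality. Orthogonal changes
of coordinates preserve output normality (`IsOutputNormal.conj`), so each form only has to be
reached by an orthogonal matrix, for an arbitrary pair.

The two observer forms come from an adaptive Gram–Schmidt process (`exists_orthonormal_flag`): the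
`k`-th target vector must lie in the span of `u 0, …, u k`, and may depend on the earlier `u i`. The
targets are rows of `C`, followed by images of earlier columns under `Aᵀ` (triangular form) or `A`
(Hessenberg form).

The Schur form comes from orthogonal deflation (`exists_orthogonal_deflation`). Non-real eigenvalues
are removed first, each time a least one for `EigLE`, through a real invariant plane; the real ones
follow. Each `2 × 2` block has positive determinant, and diagonalizing `Zᵀ Z` orthogonally brings it
to *qd* form. -/

open Matrix

namespace OutputPair

/-! ### Stability and the observability Gramian. -/

section Gramian

attribute [local instance] Matrix.frobeniusNormedAddCommGroup Matrix.frobeniusNormedSpace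
  Matrix.frobeniusNormedRing Matrix.frobeniusNormedAlgebra

/-- The powers of a stable matrix decay geometrically. -/
theorem IsStable.exists_norm_pow_le {n : ℕ} {A : Matrix (Fin n) (Fin n) ℝ} (hA : IsStable A) :
    ∃ r : ℝ, 0 ≤ r ∧ r < 1 ∧ ∀ᶠ k : ℕ in Filter.atTop, ‖A ^ k‖ ≤ r ^ k := by
  rcases subsingleton_or_nontrivial (Matrix (Fin n) (Fin n) ℂ) with hs | hn
  · refine ⟨0, le_rfl, one_pos, Filter.Eventually.of_forall fun k => ?_⟩
    have hz : (A ^ k).map (algebraMap ℝ ℂ) = 0 := Subsingleton.elim _ _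
    have : A ^ k = 0 := by
      ext i j
      have := congrFun (congrFun hz i) j
      simpa using this
    simp only [this, norm_zero]
    positivity
  · set M : Matrix (Fin n) (Fin n) ℂ := A.map (algebraMap ℝ ℂ) with hM
    have : CompleteSpace (Matrix (Fin n) (Fin n) ℂ) := FiniteDimensional.complete ℂ _
    have hρ : spectralRadius ℂ M < (1 : NNReal) :=
      spectrum.spectralRadius_lt_of_forall_lt M fun z hz => by
        have := hA z hz
        exact_mod_cast this
    -- Any `r` strictly between the spectral radius and 1 works, by Gelfand's formula.
    obtain ⟨r, hr1, hr2⟩ := ENNReal.lt_iff_exists_nnreal_btwn.1 hρ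
    refine ⟨r, r.2, by exact_mod_cast hr2, ?_⟩
    have ht := spectrum.pow_nnnorm_pow_one_div_tendsto_nhds_spectralRadius M
    filter_upwards [ht.eventually (gt_mem_nhds hr1), Filter.eventually_gt_atTop 0] with k hk hk0
    have hk' : (‖M ^ k‖₊ : ENNReal) ≤ (r : ENNReal) ^ k := by
      have h2 := ENNReal.rpow_le_rpow hk.le (Nat.cast_nonneg k)
      rw [← ENNReal.rpow_mul, one_div, inv_mul_cancel₀ (by exact_mod_cast hk0.ne'),
        ENNReal.rpow_one, ENNReal.rpow_natCast] at h2
      exact h2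
    have h3 : ‖M ^ k‖ ≤ (r : ℝ) ^ k := by exact_mod_cast hk'
    have h4 : M ^ k = (A ^ k).map (algebraMap ℝ ℂ) := by
      rw [hM]
      exact (map_pow (algebraMap ℝ ℂ).mapMatrix A k).symm
    -- The Frobenius norm is unchanged by the entrywise embedding of the reals, so the complex bound
    -- descends to `A`.
    rwa [h4, Matrix.frobenius_norm_map_eq _ _ (fun a => by simp)] at h3

/-- The series defining the observability Gramian converges. -/
theorem IsStable.summable_gramian {n : ℕ} {A : Matrix (Fin n) (Fin n) ℝ} (hA : IsStable A)
    (G : Matrix (Fin n) (Fin n) ℝ) : Summable fun k : ℕ => (A ^ k)ᵀ * G * A ^ k := by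
  obtain ⟨r, hr0, hr1, hr⟩ := hA.exists_norm_pow_le
  have : CompleteSpace (Matrix (Fin n) (Fin n) ℝ) := FiniteDimensional.complete ℝ _
  have hs : Summable fun k : ℕ => ‖G‖ * (r ^ 2) ^ k :=
    (summable_geometric_of_lt_one (by positivity) (by nlinarith)).mul_left _
  refine Summable.of_norm_bounded_eventually_nat hs ?_
  filter_upwards [hr] with k hk
  calc ‖(A ^ k)ᵀ * G * A ^ k‖ ≤ ‖(A ^ k)ᵀ‖ * ‖G‖ * ‖A ^ k‖ :=
        (norm_mul_le _ _).trans (mul_le_mul_of_nonneg_right (norm_mul_le _ _) (norm_nonneg _))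
    _ = ‖G‖ * (‖A ^ k‖ * ‖A ^ k‖) := by rw [Matrix.frobenius_norm_transpose]; ring
    _ ≤ ‖G‖ * (r ^ k * r ^ k) := by gcongr
    _ = ‖G‖ * (r ^ 2) ^ k := by ring

end Gramian

/-- A stable observable pair has a positive definite observability Gramian solving the
Stein equation. -/
theorem exists_gramian {n d : ℕ} {A : Matrix (Fin n) (Fin n) ℝ} {C : Matrix (Fin d) (Fin n) ℝ}
    (hA : IsStable A) (hC : IsObservable A C) :
    ∃ P : Matrix (Fin n) (Fin n) ℝ, P.PosDef ∧ Aᵀ * P * A = P - Cᵀ * C := by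
  have hs := hA.summable_gramian (Cᵀ * C)
  set F : ℕ → Matrix (Fin n) (Fin n) ℝ := fun k => (A ^ k)ᵀ * (Cᵀ * C) * A ^ k with hF
  have hF' : ∀ k, F k = (C * A ^ k)ᵀ * (C * A ^ k) := fun k => by
    simp only [hF, transpose_mul, Matrix.mul_assoc]
  refine ⟨∑' k, F k, PosDef.of_dotProduct_mulVec_pos ?_ fun x hx => ?_, ?_⟩
  · change (∑' k, F k)ᴴ = _
    rw [conjTranspose_tsum]
    refine tsum_congr fun k => ?_
    rw [hF', conjTranspose_eq_transpose_of_trivial, transpose_mul, transpose_transpose]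
  · let q : Matrix (Fin n) (Fin n) ℝ →+ ℝ :=
      { toFun := fun M => star x ⬝ᵥ (M *ᵥ x)
        map_zero' := by simp
        map_add' := fun M N => by simp [add_mulVec, dotProduct_add] }
    have hq : Continuous q :=
      Continuous.dotProduct continuous_const (Continuous.matrix_mulVec continuous_id continuous_const)
    have hsum : HasSum (fun k => q (F k)) (q (∑' k, F k)) := hs.hasSum.map q hq
    have hqF : ∀ k, q (F k) = (C * A ^ k) *ᵥ x ⬝ᵥ (C * A ^ k) *ᵥ x := fun k => by
      change star x ⬝ᵥ (F k *ᵥ x) = _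
      rw [hF', ← mulVec_mulVec, dotProduct_mulVec, vecMul_transpose, star_trivial]
    have hnn : ∀ k, 0 ≤ q (F k) := fun k => by
      rw [hqF]
      exact Finset.sum_nonneg fun i _ => mul_self_nonneg _
    obtain ⟨k, hk⟩ : ∃ k, (C * A ^ k) *ᵥ x ≠ 0 := by
      by_contra! h
      exact hx (hC x h)
    have hpos : 0 < q (F k) := by
      rw [hqF]
      refine lt_of_le_of_ne (Finset.sum_nonneg fun i _ => mul_self_nonneg _) fun h => hk ?_
      exact dotProduct_self_eq_zero.1 h.symm
    exact hpos.trans_le (le_hasSum hsum k fun j _ => hnn j)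
  -- Conjugation by `A` shifts the series; what is lost is the term `F 0 = Cᵀ * C`.
  · have hshift : Aᵀ * (∑' k, F k) * A = ∑' k, F (k + 1) := by
      rw [← hs.tsum_mul_left, ← (hs.mul_left _).tsum_mul_right]
      refine tsum_congr fun k => ?_
      simp only [hF, pow_succ, transpose_mul, Matrix.mul_assoc]
    rw [hshift, hs.tsum_eq_zero_add]
    simp [hF]

/-! ### Reduction to output normal pairs and orthogonal coordinates. -/

open scoped MatrixOrder Matrix.Norms.L2Operator in
/-- A positive definite real matrix is congruent to the identity. -/
theorem exists_congr_one_of_posDef {ι : Type*} [Fintype ι] [DecidableEq ι] {P : Matrix ι ι ℝ}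
    (hP : P.PosDef) : ∃ T : (Matrix ι ι ℝ)ˣ, (T : Matrix ι ι ℝ)ᵀ * P * (T : Matrix ι ι ℝ) = 1 := by
  obtain ⟨B, hB⟩ := CStarAlgebra.nonneg_iff_eq_star_mul_self.1 hP.posSemidef.nonneg
  rw [star_eq_conjTranspose, conjTranspose_eq_transpose_of_trivial] at hB
  have hu : IsUnit B := by
    rw [isUnit_iff_isUnit_det, isUnit_iff_ne_zero]
    intro h0
    have := hP.det_pos
    rw [hB, det_mul, h0, mul_zero] at this
    exact this.false
  obtain ⟨b, rfl⟩ := hu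
  refine ⟨b⁻¹, ?_⟩
  rw [hB, ← Matrix.mul_assoc, ← transpose_mul, Units.mul_inv, transpose_one, Matrix.one_mul,
    Units.mul_inv]

theorem Similar.trans {n d : ℕ} {A A' A'' : Matrix (Fin n) (Fin n) ℝ}
    {C C' C'' : Matrix (Fin d) (Fin n) ℝ} (h : Similar A C A' C') (h' : Similar A' C' A'' C'') :
    Similar A C A'' C'' := by
  obtain ⟨T, rfl, rfl⟩ := h
  obtain ⟨S, rfl, rfl⟩ := h'
  exact ⟨T * S, by simp [Matrix.mul_assoc], by simp [Matrix.mul_assoc]⟩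

/-- A stable observable pair is similar to an output normal one. -/
theorem exists_similar_isOutputNormal {n d : ℕ} {A : Matrix (Fin n) (Fin n) ℝ}
    {C : Matrix (Fin d) (Fin n) ℝ} (hA : IsStable A) (hC : IsObservable A C) :
    ∃ A' C', Similar A C A' C' ∧ IsOutputNormal A' C' := by
  obtain ⟨P, hP, hPA⟩ := exists_gramian hA hC
  obtain ⟨T, hT⟩ := exists_congr_one_of_posDef hP
  refine ⟨_, _, ⟨T, rfl, rfl⟩, ?_⟩
  have h1 : P = (↑T⁻¹ : Matrix (Fin n) (Fin n) ℝ)ᵀ * (↑T⁻¹ : Matrix (Fin n) (Fin n) ℝ) := by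
    have h2 : (↑T⁻¹ : Matrix (Fin n) (Fin n) ℝ)ᵀ * (T : Matrix (Fin n) (Fin n) ℝ)ᵀ = 1 := by
      rw [← transpose_mul, Units.mul_inv, transpose_one]
    calc P = ((↑T⁻¹ : Matrix (Fin n) (Fin n) ℝ)ᵀ * (T : Matrix (Fin n) (Fin n) ℝ)ᵀ) * P *
          ((T : Matrix (Fin n) (Fin n) ℝ) * (↑T⁻¹ : Matrix (Fin n) (Fin n) ℝ)) := by
          rw [h2, Units.mul_inv, Matrix.one_mul, Matrix.mul_one]
      _ = (↑T⁻¹ : Matrix (Fin n) (Fin n) ℝ)ᵀ *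
          ((T : Matrix (Fin n) (Fin n) ℝ)ᵀ * P * (T : Matrix (Fin n) (Fin n) ℝ)) *
          (↑T⁻¹ : Matrix (Fin n) (Fin n) ℝ) := by simp only [Matrix.mul_assoc]
      _ = _ := by rw [hT, Matrix.mul_one]
  unfold IsOutputNormal
  calc _ = (T : Matrix (Fin n) (Fin n) ℝ)ᵀ * (Aᵀ *
          ((↑T⁻¹ : Matrix (Fin n) (Fin n) ℝ)ᵀ * (↑T⁻¹ : Matrix (Fin n) (Fin n) ℝ)) * A) * (T : Matrix (Fin n) (Fin n) ℝ) := by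
        simp only [transpose_mul, Matrix.mul_assoc]
    _ = (T : Matrix (Fin n) (Fin n) ℝ)ᵀ * P * (T : Matrix (Fin n) (Fin n) ℝ) -
        (T : Matrix (Fin n) (Fin n) ℝ)ᵀ * (Cᵀ * C) * (T : Matrix (Fin n) (Fin n) ℝ) := by
        rw [← h1, hPA, Matrix.mul_sub, Matrix.sub_mul]
    _ = _ := by rw [hT]; simp only [transpose_mul, Matrix.mul_assoc]

/-- Orthogonal changes of coordinates preserve output normality. -/
theorem IsOutputNormal.conj {n d : ℕ} {A : Matrix (Fin n) (Fin n) ℝ}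
    {C : Matrix (Fin d) (Fin n) ℝ} (h : IsOutputNormal A C) {U : Matrix (Fin n) (Fin n) ℝ}
    (hU : Uᵀ * U = 1) :
    Similar A C (Uᵀ * A * U) (C * U) ∧ IsOutputNormal (Uᵀ * A * U) (C * U) := by
  have hU' : U * Uᵀ = 1 := mul_eq_one_comm.1 hU
  refine ⟨⟨⟨U, Uᵀ, hU', hU⟩, rfl, rfl⟩, ?_⟩
  unfold IsOutputNormal at *
  calc _ = Uᵀ * (Aᵀ * (U * Uᵀ) * A) * U := by
        simp only [transpose_mul, transpose_transpose, Matrix.mul_assoc]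
    _ = _ := by
        rw [hU', Matrix.mul_one, h, Matrix.mul_sub, Matrix.sub_mul, Matrix.mul_one, hU]
        simp only [transpose_mul, Matrix.mul_assoc]

/-! ### Adaptive Gram–Schmidt. -/

section Flag

variable {E : Type*} [NormedAddCommGroup E] [InnerProductSpace ℝ E] [FiniteDimensional ℝ E]

open scoped InnerProductSpace

/-- Adding one unit vector to a proper subspace catches any prescribed vector. -/
theorem exists_unit_extension {S : Submodule ℝ E} (hS : S ≠ ⊤) (w : E) :
    ∃ v ∈ Sᗮ, ‖v‖ = 1 ∧ 0 ≤ ⟪w, v⟫_ℝ ∧ w ∈ S ⊔ Submodule.span ℝ {v} := by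
  -- Take `v` to be the normalized orthogonal component `z`, or any unit vector of `Sᗮ` when `z =
  -- 0`; the inner product is then `‖z‖`.
  obtain ⟨y, hy, z, hz, rfl⟩ := S.exists_add_mem_mem_orthogonal w
  by_cases h0 : z = 0
  · have hne : Sᗮ ≠ ⊥ := fun h => hS (S.orthogonal_eq_bot_iff.1 h)
    obtain ⟨v, hv, hv0⟩ := Submodule.exists_mem_ne_zero_of_ne_bot hne
    refine ⟨‖v‖⁻¹ • v, Sᗮ.smul_mem _ hv, norm_smul_inv_norm (𝕜 := ℝ) hv0, ?_, ?_⟩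
    · rw [h0, add_zero, inner_smul_right, S.inner_right_of_mem_orthogonal hy hv, mul_zero]
    · rw [h0, add_zero]
      exact Submodule.mem_sup_left hy
  · refine ⟨‖z‖⁻¹ • z, Sᗮ.smul_mem _ hz, norm_smul_inv_norm (𝕜 := ℝ) h0, ?_, ?_⟩
    · rw [inner_add_left, inner_smul_right, inner_smul_right,
        S.inner_right_of_mem_orthogonal hy hz, mul_zero, zero_add, real_inner_self_eq_norm_sq]
      positivity
    · refine Submodule.add_mem_sup hy (Submodule.mem_span_singleton.2 ⟨‖z‖, ?_⟩)
      rw [smul_smul, mul_inv_cancel₀ (norm_ne_zero_iff.2 h0), one_smul]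

/-- Orthonormal systems whose flag catches, at every stage, a vector that may depend on the
earlier members of the system. -/
theorem exists_orthonormal_flag (w : ℕ → (ℕ → E) → E)
    (hw : ∀ k u u', (∀ i < k, u i = u' i) → w k u = w k u') (m : ℕ)
    (hm : m ≤ Module.finrank ℝ E) :
    ∃ u : ℕ → E, (∀ i < m, ‖u i‖ = 1) ∧ (∀ i j, i < j → j < m → ⟪u i, u j⟫_ℝ = 0) ∧
      ∀ k < m, 0 ≤ ⟪w k u, u k⟫_ℝ ∧ w k u ∈ Submodule.span ℝ (u '' Set.Iic k) := by
  induction m with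
  | zero => exact ⟨fun _ => 0, by simp, by simp, by simp⟩
  | succ m ih =>
    obtain ⟨u, h1, h2, h3⟩ := ih (by omega)
    set S := Submodule.span ℝ (u '' Set.Iio m) with hSdef
    have hS : S ≠ ⊤ := by
      classical
      intro h
      have hc := finrank_span_finset_le_card (R := ℝ) ((Finset.range m).image u)
      rw [Finset.coe_image, Finset.coe_range, Set.finrank, ← hSdef, h, finrank_top] at hc
      have := Finset.card_image_le (s := Finset.range m) (f := u)
      rw [Finset.card_range] at this
      omega
    obtain ⟨v, hv, hv1, hv2, hv3⟩ := exists_unit_extension hS (w m u)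
    set u' := Function.update u m v with hu'
    have hlt : ∀ i < m, u' i = u i := fun i hi => Function.update_of_ne hi.ne _ _
    have hm' : u' m = v := Function.update_self _ _ _
    -- The case `k = m` is included: the new target does not see the vector `u' m` chosen to catch
    -- it.
    have hwk : ∀ k ≤ m, w k u' = w k u := fun k hk =>
      hw k _ _ fun i hi => hlt i (hi.trans_le hk)
    refine ⟨u', fun i hi => ?_, fun i j hij hj => ?_, fun k hk => ?_⟩
    · rcases Nat.lt_succ_iff_lt_or_eq.1 hi with h | rfl
      · rw [hlt i h, h1 i h]
      · rw [hm', hv1]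
    · rcases Nat.lt_succ_iff_lt_or_eq.1 hj with h | rfl
      · rw [hlt i (hij.trans h), hlt j h, h2 i j hij h]
      · rw [hlt i hij, hm']
        exact S.inner_right_of_mem_orthogonal (Submodule.subset_span ⟨i, hij, rfl⟩) hv
    · rw [hwk k (by omega)]
      rcases Nat.lt_succ_iff_lt_or_eq.1 hk with h | rfl
      · rw [hlt k h]
        refine ⟨(h3 k h).1, ?_⟩
        rw [Set.image_congr (s := Set.Iic k) (g := u) fun i hi => hlt i (lt_of_le_of_lt hi h)]
        exact (h3 k h).2
      · rw [hm']
        refine ⟨hv2, ?_⟩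
        have hle : S ⊔ Submodule.span ℝ {v} ≤ Submodule.span ℝ (u' '' Set.Iic k) := by
          refine sup_le (Submodule.span_le.2 ?_) (Submodule.span_le.2 ?_)
          · rintro _ ⟨i, hi, rfl⟩
            exact Submodule.subset_span ⟨i, Set.mem_Iic.2 (le_of_lt hi), hlt i hi⟩
          · rintro _ rfl
            exact Submodule.subset_span ⟨k, le_refl k, hm'⟩
        exact hle hv3

end Flag

/-! ### The two observer forms. -/

/-- An orthogonal matrix whose columns triangularize a prescribed sequence of vectors, the
first `d` of them given and the others the images of the columns under `L`. -/
theorem exists_orthogonal_flag {n : ℕ} (d : ℕ) (hd : 0 < d) (c : ℕ → Fin n → ℝ)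
    (L : Matrix (Fin n) (Fin n) ℝ) :
    ∃ U : Matrix (Fin n) (Fin n) ℝ, Uᵀ * U = 1 ∧
      (∀ k < d, ∀ j : Fin n, k < j → c k ⬝ᵥ Uᵀ j = 0) ∧
      (∀ i j : Fin n, i + d < j → (L *ᵥ Uᵀ i) ⬝ᵥ Uᵀ j = 0) ∧
      ∀ j : Fin n, (j : ℕ) = 0 → 0 ≤ c 0 ⬝ᵥ Uᵀ j := by
  let E := EuclideanSpace ℝ (Fin n)
  -- Since `0 < d`, the index `k - d` is below `k` when `d ≤ k`, as the flag lemma demands.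
  let w : ℕ → (ℕ → E) → E := fun k u =>
    if k < d then WithLp.toLp 2 (c k) else WithLp.toLp 2 (L *ᵥ (u (k - d)).ofLp)
  have hw : ∀ k u u', (∀ i < k, u i = u' i) → w k u = w k u' := by
    intro k u u' h
    simp only [w]
    split_ifs with hk
    · rfl
    · rw [h (k - d) (by omega)]
  obtain ⟨u, h1, h2, h3⟩ := exists_orthonormal_flag w hw n (by simp [E])
  have hin : ∀ x y : E, inner ℝ x y = x.ofLp ⬝ᵥ y.ofLp := fun x y => by
    change y.ofLp ⬝ᵥ star x.ofLp = _
    rw [star_trivial, dotProduct_comm]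
  have hort : ∀ k j, k < j → j < n → inner ℝ (w k u) (u j) = 0 := fun k j hkj hj => by
    have hle : Submodule.span ℝ (u '' Set.Iic k) ≤ (Submodule.span ℝ {u j})ᗮ := by
      refine Submodule.span_le.2 ?_
      rintro _ ⟨i, hi, rfl⟩
      rw [SetLike.mem_coe, Submodule.mem_orthogonal_singleton_iff_inner_left]
      exact h2 i j (lt_of_le_of_lt hi hkj) hj
    exact Submodule.mem_orthogonal_singleton_iff_inner_left.1
      (hle (h3 k (hkj.trans hj)).2)
  refine ⟨of fun i j => (u j).ofLp i, ?_, ?_, ?_, ?_⟩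
  · ext i j
    have : ((of fun i (j : Fin n) => (u j).ofLp i)ᵀ * of fun i (j : Fin n) => (u j).ofLp i) i j
        = inner ℝ (u i) (u j) := by
      rw [hin]; rfl
    rw [this, one_apply]
    split_ifs with hij
    · rw [hij, real_inner_self_eq_norm_sq, h1 j j.2, one_pow]
    · rcases lt_or_gt_of_ne hij with h | h
      · exact h2 i j h j.2
      · rw [real_inner_comm]
        exact h2 j i h i.2
  · intro k hk j hj
    have := hort k j hj j.2
    rw [hin] at this
    simpa only [w, if_pos hk] using! this
  · intro i j hij
    have := hort (i + d) j hij j.2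
    rw [hin] at this
    simpa only [w, if_neg (show ¬ (i : ℕ) + d < d by omega), Nat.add_sub_cancel] using! this
  · intro j hj
    have := (h3 j j.2).1
    rw [hin, hj] at this
    simp only [w, if_pos hd] at this
    change 0 ≤ c 0 ⬝ᵥ (u j).ofLp
    rwa [hj]

theorem conj_apply {ι κ : Type*} [Fintype ι] (A : Matrix ι ι ℝ) (U : Matrix ι κ ℝ) (i j : κ) :
    (Uᵀ * A * U) i j = Uᵀ i ⬝ᵥ (A *ᵥ Uᵀ j) := by
  rw [Matrix.mul_assoc]
  rfl

/-- Without outputs every state is invisible, including the all-ones vector. This settles `d = 0`,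
where the flag construction, which needs `0 < d`, does not apply. -/
theorem IsObservable.eq_zero_of_no_output {n : ℕ} {A : Matrix (Fin n) (Fin n) ℝ}
    {C : Matrix (Fin 0) (Fin n) ℝ} (hC : IsObservable A C) : n = 0 := by
  by_contra hn
  have := hC (fun _ => 1) fun k => Subsingleton.elim _ _
  simpa using congrFun this ⟨0, by omega⟩

/-- Observer triangular system form by orthogonal coordinates. -/
theorem exists_orthogonal_isOTS {n d : ℕ} (hd : 0 < d) (A : Matrix (Fin n) (Fin n) ℝ)
    (C : Matrix (Fin d) (Fin n) ℝ) :
    ∃ U : Matrix (Fin n) (Fin n) ℝ, Uᵀ * U = 1 ∧ IsOTS (Uᵀ * A * U) (C * U) := by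
  obtain ⟨U, hU, h1, h2, -⟩ :=
    -- Row `i` of `Uᵀ * A * U` has entries `(Aᵀ uᵢ) ⬝ uⱼ`, hence the transpose.
    exists_orthogonal_flag d hd (fun k => if h : k < d then C ⟨k, h⟩ else 0) Aᵀ
  refine ⟨U, hU, fun i j hij => ?_⟩
  obtain ⟨s, rfl⟩ := finSumFinEquiv.surjective i
  unfold stack
  rw [submatrix_apply, Equiv.symm_apply_apply]
  rcases s with a | b
  · have hij' : (a : ℕ) < j := by simpa using hij
    have := h1 a a.2 j hij'
    rw [dif_pos a.2] at this
    exact this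
  · have hij' : (b : ℕ) + d < j := by
      have : d + (b : ℕ) < j := by simpa using hij
      omega
    rw [id, fromRows_apply_inr, conj_apply, dotProduct_mulVec, ← mulVec_transpose]
    exact h2 b j hij'

/-- Hessenberg observer form by orthogonal coordinates. -/
theorem exists_orthogonal_isHO {n d : ℕ} (A : Matrix (Fin n) (Fin n) ℝ)
    (C : Matrix (Fin d) (Fin n) ℝ) :
    ∃ U : Matrix (Fin n) (Fin n) ℝ, Uᵀ * U = 1 ∧ IsHO (Uᵀ * A * U) (C * U) := by
  obtain ⟨U, hU, h1, h2, h3⟩ :=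
    -- One prescribed vector, the first row of `C`, gives the offset 1 of a Hessenberg matrix. For
    -- `d = 0` the default 0 stands in for it.
    exists_orthogonal_flag 1 one_pos (fun k => if h : k < d then C ⟨k, h⟩ else 0) A
  refine ⟨U, hU, fun i j hij => ?_, fun i j hi => ?_⟩
  · rw [conj_apply, dotProduct_comm]
    exact h2 j i hij
  · have hd : 0 < d := by have := i.2; omega
    obtain rfl : i = ⟨0, hd⟩ := Fin.ext hi
    refine ⟨fun hj => ?_, fun hj => ?_⟩
    · have := h1 0 one_pos j hj
      rw [dif_pos hd] at this
      exact this
    · have := h3 j hj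
      rw [dif_pos hd] at this
      exact this

/-! ### Complex spectra of real matrices. -/

/-- The complex spectrum of a real matrix. -/
def cspec {ι : Type*} [Fintype ι] [DecidableEq ι] (A : Matrix ι ι ℝ) : Set ℂ :=
  spectrum ℂ (A.map (algebraMap ℝ ℂ))

section Spectrum

variable {ι κ : Type*} [Fintype ι] [DecidableEq ι] [Fintype κ] [DecidableEq κ]

/-- Similarity, reindexing and block triangularity thereby become identities between real
characteristic polynomials. -/
theorem mem_cspec_iff (A : Matrix ι ι ℝ) (μ : ℂ) :
    μ ∈ cspec A ↔ Polynomial.aeval μ A.charpoly = 0 := by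
  rw [cspec, mem_spectrum_iff_isRoot_charpoly, charpoly_map, Polynomial.IsRoot,
    Polynomial.eval_map_algebraMap]

theorem cspec_congr {A : Matrix ι ι ℝ} {B : Matrix κ κ ℝ} (h : A.charpoly = B.charpoly) :
    cspec A = cspec B := by
  ext μ
  rw [mem_cspec_iff, mem_cspec_iff, h]

theorem cspec_conj (A : Matrix ι ι ℝ) {U V : Matrix ι ι ℝ} (h : V * U = 1) :
    cspec (V * A * U) = cspec A := by
  obtain ⟨u, rfl, rfl⟩ : ∃ u : (Matrix ι ι ℝ)ˣ, (u : Matrix ι ι ℝ) = U ∧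
      (↑u⁻¹ : Matrix ι ι ℝ) = V := ⟨⟨U, V, mul_eq_one_comm.1 h, h⟩, rfl, rfl⟩
  have h1 := charpoly_units_conj' u A
  rw [← coe_units_inv] at h1
  exact cspec_congr h1

theorem cspec_submatrix (A : Matrix ι ι ℝ) (e : κ ≃ ι) : cspec (A.submatrix e e) = cspec A :=
  cspec_congr (charpoly_reindex e.symm A)

theorem cspec_fromBlocks (Z : Matrix ι ι ℝ) (B : Matrix ι κ ℝ) (D : Matrix κ κ ℝ) :
    cspec (fromBlocks Z B 0 D) = cspec Z ∪ cspec D := by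
  ext μ
  rw [Set.mem_union, mem_cspec_iff, mem_cspec_iff, mem_cspec_iff, charpoly_fromBlocks_zero₂₁,
    map_mul, mul_eq_zero]

theorem cspec_finite (A : Matrix ι ι ℝ) : (cspec A).Finite := by
  have h0 := A.charpoly_monic.ne_zero
  refine (A.charpoly.rootSet_finite ℂ).subset fun μ hμ => ?_
  rw [Polynomial.mem_rootSet]
  exact ⟨h0, (mem_cspec_iff A μ).1 hμ⟩

theorem cspec_nonempty [Nonempty ι] (A : Matrix ι ι ℝ) : (cspec A).Nonempty :=
  spectrum.nonempty_of_isAlgClosed_of_finiteDimensional ℂ _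

/-- Real and imaginary parts of a complex eigenvector. -/
theorem exists_real_imaginary_eigenvector {A : Matrix ι ι ℝ} {μ : ℂ} (h : μ ∈ cspec A) :
    ∃ x y : ι → ℝ, (x ≠ 0 ∨ y ≠ 0) ∧ A *ᵥ x = μ.re • x - μ.im • y ∧
      A *ᵥ y = μ.im • x + μ.re • y := by
  rw [cspec, mem_spectrum_iff_isRoot_charpoly, Polynomial.IsRoot, eval_charpoly] at h
  obtain ⟨z, hz, hAz⟩ := exists_mulVec_eq_zero_iff.2 h
  rw [sub_mulVec, sub_eq_zero] at hAz
  have hi : ∀ i, ∑ j, (A i j : ℂ) * z j = μ * z i := fun i => by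
    have := congrFun hAz i
    simp only [scalar_apply, mulVec_diagonal] at this
    exact this.symm
  refine ⟨fun i => (z i).re, fun i => (z i).im, ?_, ?_, ?_⟩
  · by_contra! h0
    exact hz (funext fun i => Complex.ext (congrFun h0.1 i) (congrFun h0.2 i))
  · ext i
    have := congrArg Complex.re (hi i)
    simpa [mulVec, dotProduct] using! this
  · ext i
    have := congrArg Complex.im (hi i)
    rw [Complex.mul_im, add_comm] at this
    simpa [mulVec, dotProduct] using! this

end Spectrum

/-! ### Eigenvalue order and orthogonal deflation. -/

/-- The order in which eigenvalues are listed: by modulus, then by decreasing real part. -/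
def EigLE (μ ν : ℂ) : Prop := ‖μ‖ ≤ ‖ν‖ ∧ (‖ν‖ = ‖μ‖ → ν.re ≤ μ.re)

/-- Minimize the modulus, then maximize the real part among the minimizers. Deflating such an
eigenvalue first puts it correctly before all that remain. -/
theorem exists_eigLE_min {S : Set ℂ} (hf : S.Finite) (hS : S.Nonempty) :
    ∃ μ ∈ S, ∀ ν ∈ S, EigLE μ ν := by
  obtain ⟨a, ha, hmin⟩ := Set.exists_min_image S (fun z => ‖z‖) hf hS
  obtain ⟨b, ⟨hb, hba⟩, hmax⟩ := Set.exists_max_image {z ∈ S | ‖z‖ = ‖a‖} Complex.re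
    (hf.subset (Set.sep_subset _ _)) ⟨a, ha, rfl⟩
  refine ⟨b, hb, fun ν hν => ⟨?_, fun h => hmax ν ⟨hν, h.trans hba⟩⟩⟩
  rw [hba]
  exact hmin ν hν

/-- An orthonormal basis of an invariant subspace deflates the matrix. -/
theorem exists_orthogonal_deflation {p m : ℕ} {A : Matrix (Fin (p + m)) (Fin (p + m)) ℝ}
    {Q : Matrix (Fin (p + m)) (Fin p) ℝ} {Z : Matrix (Fin p) (Fin p) ℝ} (hQ : Qᵀ * Q = 1)
    (hA : A * Q = Q * Z) :
    ∃ D : Matrix (Fin m) (Fin m) ℝ, cspec A = cspec Z ∪ cspec D ∧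
      ∀ V : Matrix (Fin m) (Fin m) ℝ, Vᵀ * V = 1 →
        ∃ (U : Matrix (Fin (p + m)) (Fin (p + m)) ℝ) (B : Matrix (Fin p) (Fin m) ℝ),
          Uᵀ * U = 1 ∧ Uᵀ * A * U = (fromBlocks Z B 0 (Vᵀ * D * V)).submatrix
            finSumFinEquiv.symm finSumFinEquiv.symm := by
  have hin : ∀ x y : EuclideanSpace ℝ (Fin (p + m)), inner ℝ x y = x.ofLp ⬝ᵥ y.ofLp :=
    fun x y => by
      change y.ofLp ⬝ᵥ star x.ofLp = _
      rw [star_trivial, dotProduct_comm]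
  -- The zeros are placeholders: orthonormality is asked only on the `Sum.inl` part, and the basis
  -- extension replaces the rest.
  let v : Fin p ⊕ Fin m → EuclideanSpace ℝ (Fin (p + m)) :=
    Sum.elim (fun a => WithLp.toLp 2 (Qᵀ a)) 0
  have hv : Orthonormal ℝ ((Set.range Sum.inl).domRestrict v) := by
    rw [orthonormal_iff_ite]
    rintro ⟨_, a, rfl⟩ ⟨_, b, rfl⟩
    have := congrFun (congrFun hQ a) b
    rw [one_apply] at this
    rw [hin]
    change (Qᵀ * Q) a b = _
    rw [this]
    by_cases hab : a = b
    · subst hab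
      rw [if_pos rfl, if_pos rfl]
    · rw [if_neg hab, if_neg fun h => hab (Sum.inl_injective (congrArg Subtype.val h))]
  obtain ⟨b, hb⟩ := hv.exists_orthonormalBasis_extension_of_card_eq (by simp)
  obtain ⟨R, hR⟩ : ∃ R : Matrix (Fin (p + m)) (Fin m) ℝ, R = of fun i j => (b (Sum.inr j)).ofLp i :=
    ⟨_, rfl⟩
  have hU : (fromCols Q R)ᵀ * fromCols Q R = 1 := by
    have hcol : ∀ j, (fromCols Q R)ᵀ j = (b j).ofLp := by
      rintro (j | j)
      · rw [hb _ ⟨j, rfl⟩]; rfl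
      · rw [hR]; rfl
    ext i j
    have h1 : ((fromCols Q R)ᵀ * fromCols Q R) i j =
        (fromCols Q R)ᵀ i ⬝ᵥ (fromCols Q R)ᵀ j := rfl
    rw [h1, hcol, hcol, ← hin, one_apply]
    exact orthonormal_iff_ite.1 b.orthonormal i j
  have hUb := hU
  rw [transpose_fromCols, fromRows_mul_fromCols, ← fromBlocks_one, fromBlocks_inj] at hUb
  obtain ⟨-, hQR, hRQ, hRR⟩ := hUb
  -- The compression `Rᵀ * A * R` is fixed before `V`, so that an induction can choose `V` for it
  -- afterwards.
  have key : ∀ V : Matrix (Fin m) (Fin m) ℝ, Vᵀ * V = 1 →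
        ∃ (U : Matrix (Fin (p + m)) (Fin (p + m)) ℝ) (B : Matrix (Fin p) (Fin m) ℝ),
          Uᵀ * U = 1 ∧ Uᵀ * A * U = (fromBlocks Z B 0 (Vᵀ * (Rᵀ * A * R) * V)).submatrix
            finSumFinEquiv.symm finSumFinEquiv.symm := by
    intro V hV
    have hW : (fromCols Q (R * V))ᵀ * fromCols Q (R * V) = 1 := by
      rw [transpose_fromCols, fromRows_mul_fromCols, ← fromBlocks_one, fromBlocks_inj]
      refine ⟨hQ, ?_, ?_, ?_⟩
      · rw [← Matrix.mul_assoc, hQR, Matrix.zero_mul]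
      · rw [transpose_mul, Matrix.mul_assoc, hRQ, Matrix.mul_zero]
      · rw [transpose_mul, Matrix.mul_assoc, ← Matrix.mul_assoc Rᵀ, hRR, Matrix.one_mul, hV]
    refine ⟨(fromCols Q (R * V)).submatrix id finSumFinEquiv.symm, Qᵀ * A * (R * V), ?_, ?_⟩
    · rw [transpose_submatrix, ← submatrix_mul _ _ _ id _ Function.bijective_id, hW,
        submatrix_one_equiv]
    · have h2 : (fromCols Q (R * V))ᵀ * A * fromCols Q (R * V) =
          fromBlocks Z (Qᵀ * A * (R * V)) 0 (Vᵀ * (Rᵀ * A * R) * V) := by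
        rw [transpose_fromCols, fromRows_mul, fromRows_mul_fromCols, fromBlocks_inj]
        refine ⟨?_, rfl, ?_, ?_⟩
        · rw [Matrix.mul_assoc, hA, ← Matrix.mul_assoc, hQ, Matrix.one_mul]
        · rw [Matrix.mul_assoc, hA, transpose_mul, Matrix.mul_assoc, ← Matrix.mul_assoc Rᵀ, hRQ,
            Matrix.zero_mul, Matrix.mul_zero]
        · simp only [transpose_mul, Matrix.mul_assoc]
      rw [← h2]
      rfl
  refine ⟨Rᵀ * A * R, ?_, key⟩
  obtain ⟨U, B, hU1, hU2⟩ := key 1 (by simp)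
  rw [← cspec_conj A hU1, hU2, cspec_submatrix, cspec_fromBlocks]
  simp

/-- A basis of an invariant subspace can be orthonormalized. -/
theorem exists_orthonormal_invariant {n p : ℕ} {A : Matrix (Fin n) (Fin n) ℝ}
    {X : Matrix (Fin n) (Fin p) ℝ} {J : Matrix (Fin p) (Fin p) ℝ}
    (hX : Function.Injective X.mulVec) (hA : A * X = X * J) :
    ∃ (Q : Matrix (Fin n) (Fin p) ℝ) (T : (Matrix (Fin p) (Fin p) ℝ)ˣ), Qᵀ * Q = 1 ∧
      A * Q = Q * ((↑T⁻¹ : Matrix (Fin p) (Fin p) ℝ) * J * (T : Matrix (Fin p) (Fin p) ℝ)) := by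
  -- Orthonormalizing the columns of `X` amounts to a congruence of their Gram matrix to the
  -- identity.
  have hP : (Xᵀ * X).PosDef := by
    rw [← conjTranspose_eq_transpose_of_trivial]
    exact PosDef.conjTranspose_mul_self X hX
  obtain ⟨T, hT⟩ := exists_congr_one_of_posDef hP
  refine ⟨X * (T : Matrix (Fin p) (Fin p) ℝ), T, ?_, ?_⟩
  · rw [← hT]
    simp only [transpose_mul, Matrix.mul_assoc]
  · have h1 : (T : Matrix (Fin p) (Fin p) ℝ) * (↑T⁻¹ : Matrix (Fin p) (Fin p) ℝ) = 1 := T.mul_inv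
    rw [← Matrix.mul_assoc, hA, Matrix.mul_assoc X (T : Matrix (Fin p) (Fin p) ℝ),
      ← Matrix.mul_assoc (T : Matrix (Fin p) (Fin p) ℝ), ← Matrix.mul_assoc (T : Matrix (Fin p) (Fin p) ℝ),
      h1, Matrix.one_mul, Matrix.mul_assoc]

/-! ### Real spectrum: ordered triangular form. -/

/-- Ordered Schur form of a real matrix all of whose eigenvalues are real. -/
theorem exists_orthogonal_ordered_triangular (n : ℕ) (A : Matrix (Fin n) (Fin n) ℝ)
    (hA : ∀ μ ∈ cspec A, μ.im = 0) :
    ∃ U : Matrix (Fin n) (Fin n) ℝ, Uᵀ * U = 1 ∧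
      (∀ i j, j < i → (Uᵀ * A * U) i j = 0) ∧
      (∀ i, (((Uᵀ * A * U) i i : ℝ) : ℂ) ∈ cspec A) ∧
      ∀ i j, i < j → EigLE ((Uᵀ * A * U) i i : ℝ) ((Uᵀ * A * U) j j : ℝ) := by
  -- That the diagonal entries lie in `cspec A` is carried along so that the minimal `μ` can be
  -- compared with the later ones.
  induction n using Nat.strong_induction_on with
  | _ n ih =>
    rcases Nat.eq_zero_or_pos n with rfl | hn
    · exact ⟨1, by simp, fun i => i.elim0, fun i => i.elim0, fun i => i.elim0⟩
    obtain ⟨m, rfl⟩ : ∃ m, n = 1 + m := ⟨n - 1, by omega⟩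
    obtain ⟨μ, hμ, hmin⟩ := exists_eigLE_min (cspec_finite A) (cspec_nonempty A)
    obtain ⟨x, y, hxy, hx, hy⟩ := exists_real_imaginary_eigenvector hμ
    rw [hA μ hμ, zero_smul] at hx hy
    rw [sub_zero] at hx
    rw [zero_add] at hy
    obtain ⟨z, hz, hAz⟩ : ∃ z : Fin (1 + m) → ℝ, z ≠ 0 ∧ A *ᵥ z = μ.re • z :=
      hxy.elim (fun h => ⟨x, h, hx⟩) (fun h => ⟨y, h, hy⟩)
    have hX : Function.Injective (of fun i (_ : Fin 1) => z i).mulVec := by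
      intro v w h
      obtain ⟨i, hi⟩ := Function.ne_iff.1 hz
      have := congrFun h i
      simp only [mulVec, dotProduct, of_apply, Fin.sum_univ_one] at this
      ext j
      rw [Subsingleton.elim j 0]
      exact mul_left_cancel₀ hi this
    have hAX : A * (of fun i (_ : Fin 1) => z i) =
        (of fun i (_ : Fin 1) => z i) * (μ.re • (1 : Matrix (Fin 1) (Fin 1) ℝ)) := by
      ext i j
      rw [Matrix.mul_smul, Matrix.mul_one]
      exact congrFun hAz i
    obtain ⟨Q, T, hQ, hAQ⟩ := exists_orthonormal_invariant hX hAX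
    rw [Matrix.mul_smul, Matrix.mul_one, Matrix.smul_mul, Units.inv_mul] at hAQ
    obtain ⟨D, hD, hV⟩ := exists_orthogonal_deflation hQ hAQ
    have hsub : cspec D ⊆ cspec A := hD ▸ Set.subset_union_right
    obtain ⟨V, hVV, h1, h2, h3⟩ := ih m (by omega) D fun ν hν => hA ν (hsub hν)
    obtain ⟨U, B, hU, hUA⟩ := hV V hVV
    have hre : ((μ.re : ℝ) : ℂ) = μ := Complex.ext rfl (hA μ hμ).symm
    have hval : ∀ a : Fin 1, ((finSumFinEquiv (Sum.inl a) : Fin (1 + m)) : ℕ) = 0 := fun a => by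
      have := a.2
      simp
    have hval' : ∀ b : Fin m, ((finSumFinEquiv (Sum.inr b) : Fin (1 + m)) : ℕ) = 1 + b :=
      fun b => by simp
    refine ⟨U, hU, ?_, ?_, ?_⟩
    · intro i j hij
      obtain ⟨s, rfl⟩ := finSumFinEquiv.surjective i
      obtain ⟨t, rfl⟩ := finSumFinEquiv.surjective j
      rw [Fin.lt_def] at hij
      rw [hUA, submatrix_apply, Equiv.symm_apply_apply, Equiv.symm_apply_apply]
      rcases s with a | a <;> rcases t with b | b
      · rw [hval, hval] at hij; omega
      · rw [hval] at hij; omega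
      · rfl
      · rw [hval', hval'] at hij
        exact h1 a b (by rw [Fin.lt_def]; omega)
    · intro i
      obtain ⟨s, rfl⟩ := finSumFinEquiv.surjective i
      rw [hUA, submatrix_apply, Equiv.symm_apply_apply]
      rcases s with a | a
      · rw [fromBlocks_apply₁₁, Matrix.smul_apply, one_apply_eq, smul_eq_mul, mul_one, hre]
        exact hμ
      · exact hsub (h2 a)
    · intro i j hij
      obtain ⟨s, rfl⟩ := finSumFinEquiv.surjective i
      obtain ⟨t, rfl⟩ := finSumFinEquiv.surjective j
      rw [Fin.lt_def] at hij
      rw [hUA, submatrix_apply, submatrix_apply, Equiv.symm_apply_apply, Equiv.symm_apply_apply]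
      rcases s with a | a <;> rcases t with b | b
      · rw [hval, hval] at hij; omega
      · rw [fromBlocks_apply₁₁, Matrix.smul_apply, one_apply_eq, smul_eq_mul, mul_one, hre]
        exact hmin _ (hsub (h2 b))
      · rw [hval] at hij; omega
      · rw [hval', hval'] at hij
        exact h3 a b (by rw [Fin.lt_def]; omega)

/-! ### Two-by-two blocks and the *qd* form. -/

section TwoByTwo

/-- Real and imaginary parts of `μ² - tr Z μ + det Z = 0`. The second has the factor `μ.im`, so a
non-real root forces the trace to be `2 * μ.re`. -/
theorem mem_eigs_iff (Z : Matrix (Fin 2) (Fin 2) ℝ) (μ : ℂ) :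
    μ ∈ cspec Z ↔ μ.re ^ 2 - μ.im ^ 2 - Z.trace * μ.re + Z.det = 0 ∧
      2 * μ.re * μ.im - Z.trace * μ.im = 0 := by
  have h : Polynomial.aeval μ Z.charpoly = μ * μ - (Z.trace : ℂ) * μ + (Z.det : ℂ) := by
    rw [charpoly_fin_two]
    simp [pow_two]
  have hre : (μ * μ - (Z.trace : ℂ) * μ + (Z.det : ℂ)).re =
      μ.re ^ 2 - μ.im ^ 2 - Z.trace * μ.re + Z.det := by
    simp only [Complex.add_re, Complex.sub_re, Complex.mul_re, Complex.ofReal_re,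
      Complex.ofReal_im]
    ring
  have him : (μ * μ - (Z.trace : ℂ) * μ + (Z.det : ℂ)).im =
      2 * μ.re * μ.im - Z.trace * μ.im := by
    simp only [Complex.add_im, Complex.sub_im, Complex.mul_im, Complex.ofReal_re,
      Complex.ofReal_im]
    ring
  rw [mem_cspec_iff, h, Complex.ext_iff, hre, him, Complex.zero_re, Complex.zero_im]

/-- A real `2 × 2` matrix with one non-real eigenvalue has positive determinant, and its
eigenvalues are non-real with the same modulus and real part. -/
theorem eigs_of_nonreal {Z : Matrix (Fin 2) (Fin 2) ℝ} {μ : ℂ} (hμ : μ ∈ cspec Z)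
    (him : μ.im ≠ 0) :
    0 < Z.det ∧ ∀ ν ∈ cspec Z, ν.im ≠ 0 ∧ ‖ν‖ = ‖μ‖ ∧ ν.re = μ.re := by
  obtain ⟨h1, h2⟩ := (mem_eigs_iff Z μ).1 hμ
  have htr : Z.trace = 2 * μ.re := by
    have : (2 * μ.re - Z.trace) * μ.im = 0 := by linarith
    rcases mul_eq_zero.1 this with h | h
    · linarith
    · exact absurd h him
  have hdet : Z.det = μ.re ^ 2 + μ.im ^ 2 := by rw [htr] at h1; linarith
  have hpos : 0 < μ.im ^ 2 := by positivity
  refine ⟨by rw [hdet]; positivity, fun ν hν => ?_⟩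
  obtain ⟨h3, h4⟩ := (mem_eigs_iff Z ν).1 hν
  rw [htr] at h3 h4
  -- A real root would give `(ν.re - μ.re)² + μ.im² = 0`.
  have hν0 : ν.im ≠ 0 := fun h0 => by
    rw [h0, hdet] at h3
    nlinarith [sq_nonneg (ν.re - μ.re)]
  have hre : ν.re = μ.re := by
    have : (ν.re - μ.re) * ν.im = 0 := by linarith
    rcases mul_eq_zero.1 this with h | h
    · linarith
    · exact absurd h hν0
  refine ⟨hν0, ?_, hre⟩
  have : ν.im ^ 2 = μ.im ^ 2 := by rw [hre, hdet] at h3; linarith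
  rw [← sq_eq_sq₀ (norm_nonneg _) (norm_nonneg _), Complex.sq_norm, Complex.sq_norm,
    Complex.normSq_apply, Complex.normSq_apply, hre]
  linarith

/-- A `2 × 2` matrix with positive determinant and orthogonal, suitably ordered and oriented
columns is in *qd* form. -/
theorem isQD_of_orthogonal_columns {p q r t : ℝ} (hdet : 0 < p * t - q * r)
    (hort : p * q + r * t = 0) (hle : q ^ 2 + t ^ 2 ≤ p ^ 2 + r ^ 2) (hr : r ≤ 0) :
    IsQD !![p, q; r, t] := by
  have hD : 0 < p ^ 2 + r ^ 2 := by
    by_contra! h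
    have hp : p = 0 := by nlinarith [sq_nonneg p, sq_nonneg r]
    have hr : r = 0 := by nlinarith [sq_nonneg p, sq_nonneg r]
    simp [hp, hr] at hdet
  set D := √(p ^ 2 + r ^ 2) with hDdef
  have hD0 : 0 < D := Real.sqrt_pos.2 hD
  have hD2 : D ^ 2 = p ^ 2 + r ^ 2 := Real.sq_sqrt hD.le
  -- The second column is orthogonal to the first, hence `det / D²` times `(-r, p)`. This dictates
  -- the witnesses below: `d₁ = D`, `d₂ = det / D`, and the first column `D (c, -s)`.
  have hq : q * (p ^ 2 + r ^ 2) = -r * (p * t - q * r) := by linear_combination p * hort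
  have ht : t * (p ^ 2 + r ^ 2) = p * (p * t - q * r) := by linear_combination r * hort
  have hd : (p * t - q * r) ^ 2 = (q ^ 2 + t ^ 2) * (p ^ 2 + r ^ 2) := by
    linear_combination (-(p * q + r * t)) * hort
  refine ⟨p / D, -r / D, D, (p * t - q * r) / D, ?_, ?_, ?_, ?_, ?_⟩
  · field_simp
    linarith
  · exact div_nonneg (by linarith) hD0.le
  · positivity
  · rw [div_le_iff₀ hD0, ← pow_two]
    refine le_of_sq_le_sq ?_ (by positivity)
    rw [hd, hD2, pow_two (p ^ 2 + r ^ 2)]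
    exact mul_le_mul_of_nonneg_right hle hD.le
  · have e1 : p = p / D * D := by field_simp
    have e2 : r = -(-r / D) * D := by field_simp
    have e3 : q = -r / D * ((p * t - q * r) / D) := by
      field_simp
      rw [hD2]; linarith
    have e4 : t = p / D * ((p * t - q * r) / D) := by
      field_simp
      rw [hD2]; linarith
    ext i j
    fin_cases i <;> fin_cases j <;> simp [Matrix.mul_apply, Fin.sum_univ_two]
    · exact e1
    · exact e3
    · linarith [e2]
    · exact e4

/-- Conjugating by a signed permutation keeps the determinant and the orthogonality of the columns.
A swap puts the longer column first, and a sign change makes the lower left entry nonpositive. -/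
theorem exists_orthogonal_isQD_of_orthogonal_columns {p q r t : ℝ} (hdet : 0 < p * t - q * r)
    (hort : p * q + r * t = 0) :
    ∃ V : Matrix (Fin 2) (Fin 2) ℝ, Vᵀ * V = 1 ∧ IsQD (Vᵀ * !![p, q; r, t] * V) := by
  rcases le_total (q ^ 2 + t ^ 2) (p ^ 2 + r ^ 2) with hle | hle
  · rcases le_total r 0 with hr | hr
    · exact ⟨1, by simp, by simpa using isQD_of_orthogonal_columns hdet hort hle hr⟩
    · refine ⟨!![1, 0; 0, -1], ?_, ?_⟩
      · ext i j; fin_cases i <;> fin_cases j <;> simp [Matrix.mul_apply, Fin.sum_univ_two]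
      · have : !![1, 0; 0, -1]ᵀ * !![p, q; r, t] * !![1, 0; 0, -1] = !![p, -q; -r, t] := by
          ext i j; fin_cases i <;> fin_cases j <;> simp [Matrix.mul_apply, Fin.sum_univ_two]
        rw [this]
        exact isQD_of_orthogonal_columns (by linarith) (by linarith) (by linarith) (by linarith)
  · rcases le_total q 0 with hq | hq
    · refine ⟨!![0, 1; 1, 0], ?_, ?_⟩
      · ext i j; fin_cases i <;> fin_cases j <;> simp [Matrix.mul_apply, Fin.sum_univ_two]
      · have : !![0, 1; 1, 0]ᵀ * !![p, q; r, t] * !![0, 1; 1, 0] = !![t, r; q, p] := by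
          ext i j; fin_cases i <;> fin_cases j <;> simp [Matrix.mul_apply, Fin.sum_univ_two]
        rw [this]
        exact isQD_of_orthogonal_columns (by linarith) (by linarith) (by linarith) (by linarith)
    · refine ⟨!![0, -1; 1, 0], ?_, ?_⟩
      · ext i j; fin_cases i <;> fin_cases j <;> simp [Matrix.mul_apply, Fin.sum_univ_two]
      · have : !![0, -1; 1, 0]ᵀ * !![p, q; r, t] * !![0, -1; 1, 0] = !![t, -r; -q, p] := by
          ext i j; fin_cases i <;> fin_cases j <;> simp [Matrix.mul_apply, Fin.sum_univ_two]
        rw [this]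
        exact isQD_of_orthogonal_columns (by linarith) (by linarith) (by linarith) (by linarith)

/-- A real `2 × 2` matrix with positive determinant is orthogonally similar to one in *qd*
form. -/
theorem exists_orthogonal_isQD {Z : Matrix (Fin 2) (Fin 2) ℝ} (hZ : 0 < Z.det) :
    ∃ V : Matrix (Fin 2) (Fin 2) ℝ, Vᵀ * V = 1 ∧ IsQD (Vᵀ * Z * V) := by
  have hH : (Zᵀ * Z).IsHermitian := by
    rw [IsHermitian, conjTranspose_eq_transpose_of_trivial, transpose_mul, transpose_transpose]
  obtain ⟨W, hW⟩ : ∃ W : Matrix (Fin 2) (Fin 2) ℝ, W = hH.eigenvectorUnitary := ⟨_, rfl⟩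
  have hWW : Wᵀ * W = 1 := by
    rw [hW, ← conjTranspose_eq_transpose_of_trivial]
    exact Unitary.coe_star_mul_self hH.eigenvectorUnitary
  have hWW' : W * Wᵀ = 1 := mul_eq_one_comm.1 hWW
  have hdiag : Wᵀ * (Zᵀ * Z) * W = diagonal hH.eigenvalues := by
    have := hH.conjStarAlgAut_star_eigenvectorUnitary
    rw [Unitary.conjStarAlgAut_star_apply] at this
    rw [hW, ← conjTranspose_eq_transpose_of_trivial]
    exact this
  -- In the eigenbasis of `Zᵀ * Z` the columns of the conjugated matrix are orthogonal.
  obtain ⟨M, hM⟩ : ∃ M, M = Wᵀ * Z * W := ⟨_, rfl⟩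
  have hMM : Mᵀ * M = diagonal hH.eigenvalues := by
    rw [← hdiag, hM]
    calc _ = Wᵀ * Zᵀ * (W * Wᵀ) * (Z * W) := by
          simp only [transpose_mul, transpose_transpose, Matrix.mul_assoc]
      _ = _ := by rw [hWW', Matrix.mul_one]; simp only [Matrix.mul_assoc]
  have hort : M 0 0 * M 0 1 + M 1 0 * M 1 1 = 0 := by
    have := congrFun (congrFun hMM 0) 1
    simpa [Matrix.mul_apply, Fin.sum_univ_two] using this
  have hdet : 0 < M 0 0 * M 1 1 - M 0 1 * M 1 0 := by
    have h1 : M.det = Z.det := by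
      rw [hM, det_mul, det_mul, mul_comm Wᵀ.det, mul_assoc, ← det_mul, hWW, det_one, mul_one]
    rwa [← det_fin_two, h1]
  obtain ⟨V, hV, hQD⟩ := exists_orthogonal_isQD_of_orthogonal_columns hdet hort
  rw [← eta_fin_two M, hM] at hQD
  refine ⟨W * V, ?_, ?_⟩
  · rw [transpose_mul, Matrix.mul_assoc, ← Matrix.mul_assoc Wᵀ, hWW, Matrix.one_mul, hV]
  · simpa only [transpose_mul, Matrix.mul_assoc] using hQD

end TwoByTwo

/-! ### Invariant planes of non-real eigenvalues. -/

/-- Real and imaginary parts of an eigenvector to a non-real eigenvalue are linearly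
independent. -/
theorem injective_mulVec_of_nonreal {n : ℕ} {A : Matrix (Fin n) (Fin n) ℝ} {x y : Fin n → ℝ}
    {a b : ℝ} (hb : b ≠ 0) (hxy : x ≠ 0 ∨ y ≠ 0) (hx : A *ᵥ x = a • x - b • y)
    (hy : A *ᵥ y = b • x + a • y) :
    Function.Injective (of fun i => ![x i, y i] : Matrix (Fin n) (Fin 2) ℝ).mulVec := by
  have key : ∀ α β : ℝ, α • x + β • y = 0 → α = 0 ∧ β = 0 := by
    intro α β h
    -- Applying `A` to the relation and subtracting `a` times it leaves `b` times this one; the two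
    -- together annihilate `x` and `y` unless `α = β = 0`.
    have h1 : β • x - α • y = 0 := by
      have h2 : A *ᵥ (α • x + β • y) = 0 := by rw [h, mulVec_zero]
      rw [mulVec_add, mulVec_smul, mulVec_smul, hx, hy] at h2
      have h3 : b • (β • x - α • y) = 0 := by
        calc b • (β • x - α • y) = (α • (a • x - b • y) + β • (b • x + a • y)) -
              a • (α • x + β • y) := by module
          _ = 0 := by rw [h2, h, smul_zero, sub_zero]
      exact (smul_eq_zero.1 h3).resolve_left hb
    by_contra hne
    have hs : α ^ 2 + β ^ 2 ≠ 0 := by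
      intro h0
      exact hne ⟨by nlinarith [sq_nonneg α, sq_nonneg β], by nlinarith [sq_nonneg α, sq_nonneg β]⟩
    have hx0 : (α ^ 2 + β ^ 2) • x = 0 := by
      calc (α ^ 2 + β ^ 2) • x = α • (α • x + β • y) + β • (β • x - α • y) := by module
        _ = 0 := by rw [h, h1, smul_zero, smul_zero, add_zero]
    have hy0 : (α ^ 2 + β ^ 2) • y = 0 := by
      calc (α ^ 2 + β ^ 2) • y = β • (α • x + β • y) - α • (β • x - α • y) := by module
        _ = 0 := by rw [h, h1, smul_zero, smul_zero, sub_zero]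
    exact hxy.elim (fun h' => h' ((smul_eq_zero.1 hx0).resolve_left hs))
      (fun h' => h' ((smul_eq_zero.1 hy0).resolve_left hs))
  intro v w hvw
  have h0 := key (v 0 - w 0) (v 1 - w 1) <| by
    ext i
    have := congrFun hvw i
    simp only [mulVec, dotProduct, Fin.sum_univ_two, of_apply, cons_val_zero, cons_val_one] at this
    simp only [Pi.add_apply, Pi.smul_apply, smul_eq_mul, Pi.zero_apply]
    linarith
  ext i
  fin_cases i
  · exact sub_eq_zero.1 h0.1
  · exact sub_eq_zero.1 h0.2

/-- A non-real eigenvalue gives an invariant plane with an orthonormal basis in which the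
matrix is in *qd* form. -/
theorem exists_orthonormal_isQD_of_nonreal {n : ℕ} {A : Matrix (Fin n) (Fin n) ℝ} {μ : ℂ}
    (hμ : μ ∈ cspec A) (him : μ.im ≠ 0) :
    2 ≤ n ∧ ∃ (Q : Matrix (Fin n) (Fin 2) ℝ) (Z : Matrix (Fin 2) (Fin 2) ℝ), Qᵀ * Q = 1 ∧
      A * Q = Q * Z ∧ IsQD Z ∧ μ ∈ cspec Z := by
  obtain ⟨x, y, hxy, hx, hy⟩ := exists_real_imaginary_eigenvector hμ
  have hX := injective_mulVec_of_nonreal him hxy hx hy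
  have hAX : A * (of fun i => ![x i, y i] : Matrix (Fin n) (Fin 2) ℝ) =
      (of fun i => ![x i, y i] : Matrix (Fin n) (Fin 2) ℝ) *
        !![μ.re, μ.im; -μ.im, μ.re] := by
    ext i j
    fin_cases j
    · have := congrFun hx i
      simp only [Pi.sub_apply, Pi.smul_apply, smul_eq_mul] at this
      simp only [Matrix.mul_apply, Fin.sum_univ_two]
      simp only [mulVec, dotProduct] at this
      simpa [sub_eq_add_neg, mul_comm] using this
    · have := congrFun hy i
      simp only [Pi.add_apply, Pi.smul_apply, smul_eq_mul] at this
      simp only [Matrix.mul_apply, Fin.sum_univ_two]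
      simp only [mulVec, dotProduct] at this
      simpa [mul_comm] using this
  have hn : 2 ≤ n := by
    have := LinearMap.finrank_le_finrank_of_injective (f := Matrix.mulVecLin _) hX
    simpa using this
  obtain ⟨Q, T, hQ, hAQ⟩ := exists_orthonormal_invariant hX hAX
  obtain ⟨Z, hZ⟩ : ∃ Z, Z = (↑T⁻¹ : Matrix (Fin 2) (Fin 2) ℝ) * !![μ.re, μ.im; -μ.im, μ.re] *
      (T : Matrix (Fin 2) (Fin 2) ℝ) := ⟨_, rfl⟩
  have hμZ : μ ∈ cspec Z := by
    rw [hZ, cspec_conj _ T.inv_mul, mem_eigs_iff, trace_fin_two, det_fin_two]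
    constructor <;> simp <;> ring
  rw [← hZ] at hAQ
  obtain ⟨V, hV, hQD⟩ := exists_orthogonal_isQD (eigs_of_nonreal hμZ him).1
  refine ⟨hn, Q * V, Vᵀ * Z * V, ?_, ?_, hQD, ?_⟩
  · rw [transpose_mul, Matrix.mul_assoc, ← Matrix.mul_assoc Qᵀ, hQ, Matrix.one_mul, hV]
  · have hV' : V * Vᵀ = 1 := mul_eq_one_comm.1 hV
    calc A * (Q * V) = Q * (1 * Z) * V := by rw [← Matrix.mul_assoc, hAQ, Matrix.one_mul]
      _ = Q * V * (Vᵀ * Z * V) := by rw [← hV']; simp only [Matrix.mul_assoc]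
  · rwa [cspec_conj _ hV]

/-! ### Index bookkeeping when a leading block is added. -/

section Assembly

variable {m l : ℕ} {Z : Matrix (Fin 2) (Fin 2) ℝ} {B : Matrix (Fin 2) (Fin m) ℝ}
  {D : Matrix (Fin m) (Fin m) ℝ} {A : Matrix (Fin (2 + m)) (Fin (2 + m)) ℝ}

theorem blockIndex_inl (a : Fin 2) :
    blockIndex (l + 1) (finSumFinEquiv (Sum.inl a) : Fin (2 + m)) = 0 := by
  have h : ((finSumFinEquiv (Sum.inl a) : Fin (2 + m)) : ℕ) < 2 := by
    rw [finSumFinEquiv_apply_left, Fin.val_castAdd]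
    exact a.2
  unfold blockIndex
  split_ifs <;> omega

/-- In the scalar range this reads `2 + b - (l + 1) = (b - l) + 1`, with no truncation because `2 *
l ≤ b` there. -/
theorem blockIndex_inr (b : Fin m) :
    blockIndex (l + 1) (finSumFinEquiv (Sum.inr b) : Fin (2 + m)) = blockIndex l b + 1 := by
  have h : ((finSumFinEquiv (Sum.inr b) : Fin (2 + m)) : ℕ) = 2 + b := by
    rw [finSumFinEquiv_apply_right, Fin.val_natAdd]
  unfold blockIndex
  split_ifs <;> omega

theorem blockTriangular_succ
    (hA : A = (fromBlocks Z B 0 D).submatrix finSumFinEquiv.symm finSumFinEquiv.symm)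
    (hD : D.BlockTriangular (blockIndex l)) : A.BlockTriangular (blockIndex (l + 1)) := by
  intro i j hij
  obtain ⟨s, rfl⟩ := finSumFinEquiv.surjective i
  obtain ⟨t, rfl⟩ := finSumFinEquiv.surjective j
  rw [hA, submatrix_apply, Equiv.symm_apply_apply, Equiv.symm_apply_apply]
  rcases s with a | a <;> rcases t with b | b
  · rw [blockIndex_inl, blockIndex_inl] at hij; omega
  · rw [blockIndex_inl] at hij; omega
  · rfl
  · rw [blockIndex_inr, blockIndex_inr] at hij
    exact hD (by omega)

theorem diagBlock_zero
    (hA : A = (fromBlocks Z B 0 D).submatrix finSumFinEquiv.symm finSumFinEquiv.symm)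
    (hl : 2 * (l + 1) ≤ 2 + m) : diagBlock A hl 0 = Z := by
  ext a b
  have h : ∀ (a : Fin 2) (h : 2 * ((0 : Fin (l + 1)) : ℕ) + (a : ℕ) < 2 + m),
      (⟨2 * ((0 : Fin (l + 1)) : ℕ) + (a : ℕ), h⟩ : Fin (2 + m)) =
        finSumFinEquiv (Sum.inl a) := fun a h => Fin.ext (by simp)
  simp only [diagBlock, submatrix_apply]
  rw [h, h, hA, submatrix_apply, Equiv.symm_apply_apply, Equiv.symm_apply_apply]
  rfl

theorem diagBlock_succ
    (hA : A = (fromBlocks Z B 0 D).submatrix finSumFinEquiv.symm finSumFinEquiv.symm)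
    (hl : 2 * (l + 1) ≤ 2 + m) (hl' : 2 * l ≤ m) (k : Fin l) :
    diagBlock A hl k.succ = diagBlock D hl' k := by
  ext a b
  have h : ∀ (a : Fin 2) (h : 2 * (k.succ : ℕ) + (a : ℕ) < 2 + m)
      (h' : 2 * (k : ℕ) + (a : ℕ) < m), (⟨2 * (k.succ : ℕ) + (a : ℕ), h⟩ : Fin (2 + m)) =
        finSumFinEquiv (Sum.inr ⟨2 * (k : ℕ) + (a : ℕ), h'⟩) := fun a h h' =>
    Fin.ext (by simp; omega)
  simp only [diagBlock, submatrix_apply]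
  have := a.2
  have := b.2
  have := k.2
  rw [h a _ (by omega), h b _ (by omega), hA, submatrix_apply, Equiv.symm_apply_apply,
    Equiv.symm_apply_apply]
  rfl

end Assembly

/-! ### Ordered Schur form and conclusion. -/

/-- Ordered real Schur form with *qd* blocks by orthogonal coordinates. -/
theorem exists_orthogonal_orderedSchurQD (n : ℕ) (A : Matrix (Fin n) (Fin n) ℝ) :
    ∃ U : Matrix (Fin n) (Fin n) ℝ, Uᵀ * U = 1 ∧ ∃ (l : ℕ) (hl : 2 * l ≤ n),
      IsRealSchur (Uᵀ * A * U) hl ∧ IsOrdered (Uᵀ * A * U) hl ∧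
      (∀ k : Fin l, IsQD (diagBlock (Uᵀ * A * U) hl k)) ∧
      ∀ k : Fin l, eigs (diagBlock (Uᵀ * A * U) hl k) ⊆ cspec A := by
  -- The last conjunct serves the induction only: it places the eigenvalues of later blocks in the
  -- set over which `μ` is minimal.
  induction n using Nat.strong_induction_on with
  | _ n ih =>
    by_cases hreal : ∀ μ ∈ cspec A, μ.im = 0
    · obtain ⟨U, hU, h1, -, h3⟩ := exists_orthogonal_ordered_triangular n A hreal
      refine ⟨U, hU, 0, by omega, ⟨fun i j hij => h1 i j ?_, fun k => k.elim0⟩,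
        ⟨fun k => k.elim0, fun i j _ hij => ?_⟩, fun k => k.elim0, fun k => k.elim0⟩
      · simpa [blockIndex] using hij
      · simpa [EigLE] using h3 i j hij
    push Not at hreal
    obtain ⟨μ, ⟨hμ, him⟩, hmin⟩ := exists_eigLE_min (S := {μ ∈ cspec A | μ.im ≠ 0})
      ((cspec_finite A).subset (Set.sep_subset _ _)) hreal
    obtain ⟨hn, Q, Z, hQ, hAQ, hQD, hμZ⟩ := exists_orthonormal_isQD_of_nonreal hμ him
    obtain ⟨m, rfl⟩ : ∃ m, n = 2 + m := ⟨n - 2, by omega⟩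
    obtain ⟨D, hD, hV⟩ := exists_orthogonal_deflation hQ hAQ
    obtain ⟨V, hVV, l, hl', ⟨hT, hN⟩, ⟨hO1, hO2⟩, hq, hsub⟩ := ih m (by omega) D
    obtain ⟨U, B, hU, hUA⟩ := hV V hVV
    have hl : 2 * (l + 1) ≤ 2 + m := by omega
    have hb0 := diagBlock_zero hUA hl
    have hbs := diagBlock_succ hUA hl hl'
    have hZ := (eigs_of_nonreal hμZ him).2
    have hDA : cspec D ⊆ cspec A := hD ▸ Set.subset_union_right
    have hZA : cspec Z ⊆ cspec A := hD ▸ Set.subset_union_left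
    refine ⟨U, hU, l + 1, hl, ⟨blockTriangular_succ hUA hT, ?_⟩, ⟨?_, ?_⟩, ?_, ?_⟩
    · intro k
      refine Fin.cases ?_ (fun k => ?_) k
      · rw [hb0]
        exact fun ν hν => (hZ ν hν).1
      · rw [hbs]
        exact hN k
    · intro k k'
      refine Fin.cases ?_ (fun k => ?_) k <;> refine Fin.cases ?_ (fun k' => ?_) k'
      · exact fun h => absurd h (lt_irrefl _)
      · intro _
        rw [hb0, hbs]
        intro ν hν ξ hξ
        -- Both eigenvalues of `Z` share the modulus and real part of `μ`, so minimality of `μ`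
        -- covers them.
        obtain ⟨-, h1, h2⟩ := hZ ν hν
        rw [h1, h2]
        exact hmin ξ ⟨hDA (hsub k' hξ), hN k' ξ hξ⟩
      · exact fun h => absurd h (Fin.not_lt_zero _)
      · intro h
        rw [hbs, hbs]
        exact hO1 k k' (Fin.succ_lt_succ_iff.1 h)
    · intro i j hi hij
      obtain ⟨s, rfl⟩ := finSumFinEquiv.surjective i
      obtain ⟨t, rfl⟩ := finSumFinEquiv.surjective j
      rw [Fin.lt_def] at hij
      rw [hUA, submatrix_apply, submatrix_apply, Equiv.symm_apply_apply, Equiv.symm_apply_apply]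
      rcases s with a | a
      · have := a.2
        rw [finSumFinEquiv_apply_left, Fin.val_castAdd] at hi
        omega
      rcases t with b | b
      · have := b.2
        rw [finSumFinEquiv_apply_left, Fin.val_castAdd] at hij
        omega
      · rw [finSumFinEquiv_apply_right, Fin.val_natAdd] at hi hij
        rw [finSumFinEquiv_apply_right, Fin.val_natAdd] at hij
        exact hO2 a b (by omega) (by rw [Fin.lt_def]; omega)
    · intro k
      refine Fin.cases ?_ (fun k => ?_) k
      · rwa [hb0]
      · rw [hbs]
        exact hq k
    · intro k
      refine Fin.cases ?_ (fun k => ?_) k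
      · rw [hb0]
        exact hZA
      · rw [hbs]
        exact (hsub k).trans hDA

end OutputPair

theorem mainTheorem3 {n d : ℕ} (A : Matrix (Fin n) (Fin n) ℝ) (C : Matrix (Fin d) (Fin n) ℝ)
    (hstable : OutputPair.IsStable A) (hobs : OutputPair.IsObservable A C) :
    (∃ (A' : Matrix (Fin n) (Fin n) ℝ) (C' : Matrix (Fin d) (Fin n) ℝ),
      OutputPair.Similar A C A' C' ∧ OutputPair.IsOTSON A' C') ∧
    (∃ (A' : Matrix (Fin n) (Fin n) ℝ) (C' : Matrix (Fin d) (Fin n) ℝ),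
      OutputPair.Similar A C A' C' ∧ OutputPair.IsHOON A' C') ∧
    (∃ (A' : Matrix (Fin n) (Fin n) ℝ) (C' : Matrix (Fin d) (Fin n) ℝ),
      OutputPair.Similar A C A' C' ∧ OutputPair.IsOutputNormal A' C' ∧
        OutputPair.IsOrderedSchurQD A') := by
  obtain ⟨A₁, C₁, hsim, hON⟩ := OutputPair.exists_similar_isOutputNormal hstable hobs
  refine ⟨?_, ?_, ?_⟩
  · rcases Nat.eq_zero_or_pos d with rfl | hd
    · obtain rfl := hobs.eq_zero_of_no_output
      exact ⟨A₁, C₁, hsim, fun _ j => j.elim0, hON⟩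
    · obtain ⟨U, hU, h⟩ := OutputPair.exists_orthogonal_isOTS hd A₁ C₁
      exact ⟨_, _, hsim.trans (hON.conj hU).1, h, (hON.conj hU).2⟩
  · obtain ⟨U, hU, h⟩ := OutputPair.exists_orthogonal_isHO A₁ C₁
    exact ⟨_, _, hsim.trans (hON.conj hU).1, h, (hON.conj hU).2⟩
  · obtain ⟨U, hU, l, hl, h1, h2, h3, -⟩ := OutputPair.exists_orthogonal_orderedSchurQD n A₁
    exact ⟨_, _, hsim.trans (hON.conj hU).1, (hON.conj hU).2, l, hl, h1, h2, h3⟩
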